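/- For $q\in(1,2)$ and $x\in I_q:=[0,1/(q-1)]$, a $q$-expansion of $x$ is a sequence $(d_i)_{i\ge 1}\in\{0,1\}^{\mathbb N}$ with $x=\sum_{i=1}^\infty d_i q^{-i}$. Let $\mathcal B_2$ be the set of $q\in(1,2)$ for which some $x\in I_q$ has exactly two different $q$-expansions. Then $\mathcal B_2$ has a smallest element $q_2:=\min\mathcal B_2$ ($\approx 1.71064$), and every $x\in I_{q_2}=[0,1/(q_2-1)]$ has either a unique $q_2$-expansion, exactly two $q_2$-expansions, or a continuum (i.e. $2^{\aleph_0}$) of $q_2$-expansions. In particular, no other cardinality of the set of $q_2$-expansions occurs. -/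

import Mathlib

/-- The interval `I_q = [0, 1/(q-1)]`. -/
def expansionInterval (q : ℝ) : Set ℝ := Set.Icc 0 (1 / (q - 1))

/-- `Σ_q(x)`: the set of all `q`-expansions of `x`, i.e. of the sequences `(d_i)_{i ≥ 1}` in
`{0,1}` with `x = ∑_{i ≥ 1} d_i / q^i`.  The digit `d_{i+1}` is stored as `d i`. -/
def qExpansions (q x : ℝ) : Set (ℕ → Fin 2) :=
  {d | HasSum (fun i : ℕ => ((d i : ℕ) : ℝ) / q ^ (i + 1)) x}

/-- `𝓑_m`: the set of bases `q ∈ (1,2)` for which some `x ∈ I_q` has exactly `m` different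
`q`-expansions. -/
def basesWithExactly (m : Cardinal.{0}) : Set ℝ :=
  {q | q ∈ Set.Ioo (1 : ℝ) 2 ∧ ∃ x ∈ expansionInterval q, Cardinal.mk (qExpansions q x) = m}

/-- `q₂ = min 𝓑₂`, written as an infimum so that it is defined outright. -/
noncomputable def qTwo : ℝ := sInf (basesWithExactly 2)

/-! Write M = 1/(q-1), and let r be the root of r^4 = 2r^2 + r + 1 near 1.7106. If x has exactly two
expansions, they share a prefix up to a branching point, whose two successors y + 1 and y have
unique expansions. As long as q(q-1)^2 ≤ 1, the only points with a unique expansion are 0, M, the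
points a_k = 0^k(10)^∞ (`altPoint`) and the reflections M - a_k (`classification_of_mk_eq_one`). Two
of them at distance 1 would need a_k = M - 1 or a_j + a_k = M - 1, which cannot happen while q^4 <
2q^2 + q + 1; at q = r one has a_2 + a_4 = M - 1. Hence r is the minimum.

The set of expansions is closed, so if it is uncountable it has the cardinality of the continuum. If
it is countable and nonempty, it is not perfect, so some remainder has a unique expansion and x lies
in ℚ(r). Now r has a real conjugate p < -1. The conjugate of x lies in the compact interval that
contains all digit sums in base p (`IsDigitRange`), and the same holds for every remainder in I_r.
At a branching point these constraints are sharp: by `eq_or_lt_of_adjacent_countable` and reflection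
the successors are a_4, a_4 + 1 or a_2, a_2 + 1. All of these have unique expansions, so there are
exactly two expansions. -/

/-- The sequence starting with the digit `c` and continuing with `d`. -/
def consDigit (c : Fin 2) (d : ℕ → Fin 2) : ℕ → Fin 2 := fun i => Nat.casesOn i c d

/-- The sequence that follows `d` for `n` digits and continues with `f`. -/
def splice (d : ℕ → Fin 2) (n : ℕ) (f : ℕ → Fin 2) : ℕ → Fin 2 :=
  fun i => if i < n then d i else f (i - n)

/-- The number left to be expanded after the first `n` digits of `d` have been used for `x`. -/
def remainder (q x : ℝ) (d : ℕ → Fin 2) : ℕ → ℝ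
  | 0 => x
  | n + 1 => q * remainder q x d n - ((d n : ℕ) : ℝ)

/-! ### Shifting and splicing expansions -/

theorem splice_of_lt (d f : ℕ → Fin 2) {n i : ℕ} (h : i < n) : splice d n f i = d i := by
  simp [splice, h]

theorem splice_add (d f : ℕ → Fin 2) (n i : ℕ) : splice d n f (i + n) = f i := by
  simp [splice]

theorem splice_succ (d f : ℕ → Fin 2) (n : ℕ) :
    splice d (n + 1) f = splice d n (consDigit (d n) f) := by
  funext i
  rcases lt_trichotomy i n with h | h | h
  · simp [splice, h, Nat.lt_succ_of_lt h]
  · subst h; simp [splice, consDigit]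
  · obtain ⟨k, rfl⟩ := Nat.exists_eq_add_of_lt h
    have h1 : n + k + 1 - n = k + 1 := by omega
    have h2 : n + k + 1 - (n + 1) = k := by omega
    have h3 : ¬ n + k + 1 < n + 1 := by omega
    have h4 : ¬ n + k + 1 < n := by omega
    simp [splice, consDigit, h1, h2, h3, h4]

theorem mem_qExpansions_iff_tail {q : ℝ} (hq : q ≠ 0) (x : ℝ) (d : ℕ → Fin 2) :
    d ∈ qExpansions q x ↔ (fun i => d (i + 1)) ∈ qExpansions q (q * x - ((d 0 : ℕ) : ℝ)) := by
  simp only [qExpansions, Set.mem_ofPred_eq]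
  rw [← hasSum_nat_add_iff' 1, ← hasSum_mul_left_iff hq]
  have h1 : (fun i => q * (((d (i + 1) : ℕ) : ℝ) / q ^ (i + 1 + 1))) =
      fun i => ((d (i + 1) : ℕ) : ℝ) / q ^ (i + 1) := by
    funext i; rw [pow_succ q (i + 1)]; field_simp
  have h2 : q * (x - ∑ i ∈ Finset.range 1, ((d i : ℕ) : ℝ) / q ^ (i + 1)) =
      q * x - ((d 0 : ℕ) : ℝ) := by
    simp; field_simp
  rw [h1, h2]

theorem consDigit_mem {q : ℝ} (hq : q ≠ 0) {x : ℝ} {c : Fin 2} {f : ℕ → Fin 2} :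
    consDigit c f ∈ qExpansions q x ↔ f ∈ qExpansions q (q * x - ((c : ℕ) : ℝ)) := by
  rw [mem_qExpansions_iff_tail hq]
  rfl

theorem consDigit_injective (c : Fin 2) : Function.Injective (consDigit c) := fun f g h => by
  funext i
  exact congrFun h (i + 1)

theorem shift_mem {q : ℝ} (hq : q ≠ 0) {x : ℝ} {d : ℕ → Fin 2} (hd : d ∈ qExpansions q x) (n : ℕ) :
    (fun i => d (i + n)) ∈ qExpansions q (remainder q x d n) := by
  induction n with
  | zero => simpa [remainder] using hd
  | succ n ih =>
    have h := (mem_qExpansions_iff_tail hq _ _).1 ih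
    simp only [Nat.zero_add] at h
    have e : (fun i => d (i + (n + 1))) = fun i => d (i + 1 + n) := by
      funext i; congr 1; omega
    rw [e]
    exact h

theorem splice_mem {q : ℝ} (hq : q ≠ 0) {x : ℝ} {d f : ℕ → Fin 2} {n : ℕ} :
    splice d n f ∈ qExpansions q x ↔ f ∈ qExpansions q (remainder q x d n) := by
  induction n generalizing f with
  | zero => rfl
  | succ n ih =>
    rw [splice_succ, ih, consDigit_mem hq]
    rfl

theorem remainder_congr {q x : ℝ} {d e : ℕ → Fin 2} {n : ℕ} (h : ∀ i < n, d i = e i) :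
    remainder q x d n = remainder q x e n := by
  induction n with
  | zero => rfl
  | succ n ih => simp [remainder, ih (fun i hi => h i (by omega)), h n (by omega)]

/-! ### Convergence, and existence of expansions on I_q -/

theorem summable_digits {q : ℝ} (hq : 1 < q) (d : ℕ → Fin 2) :
    Summable (fun i : ℕ => ((d i : ℕ) : ℝ) / q ^ (i + 1)) := by
  have hg : Summable (fun i : ℕ => (1 / q) ^ (i + 1)) :=
    (summable_nat_add_iff 1).2 (summable_geometric_of_lt_one (by positivity)
      ((div_lt_one (by linarith)).2 hq))
  refine Summable.of_nonneg_of_le (fun i => by positivity) (fun i => ?_) hg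
  rw [one_div_pow]
  have : ((d i : ℕ) : ℝ) ≤ 1 := by exact_mod_cast (by omega : (d i : ℕ) ≤ 1)
  gcongr

theorem hasSum_all_ones {q : ℝ} (hq : 1 < q) :
    HasSum (fun i : ℕ => 1 / q ^ (i + 1)) (1 / (q - 1)) := by
  have h := (hasSum_geometric_of_lt_one (r := 1 / q) (by positivity)
    ((div_lt_one (by linarith)).2 hq)).mul_left (1 / q)
  have h1 : 1 / q * (1 - 1 / q)⁻¹ = 1 / (q - 1) := by
    have : q - 1 ≠ 0 := by linarith
    field_simp
  rw [h1] at h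
  have h2 : (fun i : ℕ => 1 / q * (1 / q) ^ i) = fun i => 1 / q ^ (i + 1) := by
    funext i
    rw [one_div_pow, pow_succ]; field_simp
  rwa [h2] at h

theorem mem_interval_of_mem {q : ℝ} (hq : 1 < q) {x : ℝ} {d : ℕ → Fin 2}
    (hd : d ∈ qExpansions q x) : 0 ≤ x ∧ x ≤ 1 / (q - 1) := by
  refine ⟨hd.nonneg fun i => by positivity, hasSum_le (fun i => ?_) hd (hasSum_all_ones hq)⟩
  have : ((d i : ℕ) : ℝ) ≤ 1 := by exact_mod_cast (by omega : (d i : ℕ) ≤ 1)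
  gcongr

/-- The n-th partial sum is x minus q^(-n) times the n-th remainder. -/
theorem mem_qExpansions_of_remainder_bounded {q : ℝ} (hq : 1 < q) {x C : ℝ} {d : ℕ → Fin 2}
    (h : ∀ n, |remainder q x d n| ≤ C) : d ∈ qExpansions q x := by
  have hq0 : q ≠ 0 := by linarith
  have hx : ∀ n, ∑ i ∈ Finset.range n, ((d i : ℕ) : ℝ) / q ^ (i + 1) =
      x - remainder q x d n * (1 / q) ^ n := by
    intro n
    induction n with
    | zero => simp [remainder]
    | succ n ih =>
      rw [Finset.sum_range_succ, ih, remainder, one_div_pow, one_div_pow, pow_succ]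
      field_simp
      ring
  have h0 : Filter.Tendsto (fun n => remainder q x d n * (1 / q) ^ n) Filter.atTop (nhds 0) := by
    refine squeeze_zero_norm (a := fun n => C * (1 / q) ^ n) (fun n => ?_) ?_
    · rw [norm_mul, Real.norm_eq_abs, norm_pow, Real.norm_of_nonneg (by positivity : 0 ≤ 1 / q)]
      exact mul_le_mul_of_nonneg_right (h n) (by positivity)
    · simpa using (tendsto_pow_atTop_nhds_zero_of_lt_one (r := 1 / q) (by positivity)
        ((div_lt_one (by linarith)).2 hq)).const_mul C
  refine ((summable_digits hq d).hasSum_iff_tendsto_nat).2 ?_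
  simp_rw [hx]
  simpa using h0.const_sub x

/-- The orbit of `x` under the greedy algorithm. -/
noncomputable def greedyOrbit (q x : ℝ) : ℕ → ℝ
  | 0 => x
  | n + 1 => if 1 ≤ q * greedyOrbit q x n then q * greedyOrbit q x n - 1
      else q * greedyOrbit q x n

theorem greedyOrbit_mem {q : ℝ} (hq : 1 < q) (hq2 : q < 2) {x : ℝ} (h0 : 0 ≤ x)
    (h1 : x ≤ 1 / (q - 1)) (n : ℕ) : 0 ≤ greedyOrbit q x n ∧ greedyOrbit q x n ≤ 1 / (q - 1) := by
  have hM : q * (1 / (q - 1)) = 1 / (q - 1) + 1 := by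
    have : q - 1 ≠ 0 := by linarith
    field_simp; ring
  have hM1 : 1 ≤ 1 / (q - 1) := by rw [le_div_iff₀ (by linarith)]; linarith
  induction n with
  | zero => exact ⟨h0, h1⟩
  | succ n ih =>
    have h2 : q * greedyOrbit q x n ≤ q * (1 / (q - 1)) :=
      mul_le_mul_of_nonneg_left ih.2 (by linarith)
    have h3 : 0 ≤ q * greedyOrbit q x n := mul_nonneg (by linarith) ih.1
    simp only [greedyOrbit]
    split_ifs <;> constructor <;> linarith

theorem qExpansions_nonempty {q : ℝ} (hq : 1 < q) (hq2 : q < 2) {x : ℝ} (h0 : 0 ≤ x)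
    (h1 : x ≤ 1 / (q - 1)) : (qExpansions q x).Nonempty := by
  let d : ℕ → Fin 2 := fun n => if 1 ≤ q * greedyOrbit q x n then 1 else 0
  have hr : ∀ n, remainder q x d n = greedyOrbit q x n := by
    intro n
    induction n with
    | zero => rfl
    | succ n ih =>
      simp only [remainder, greedyOrbit, ih, d]
      split_ifs <;> simp
  refine ⟨d, mem_qExpansions_of_remainder_bounded hq (C := 1 / (q - 1)) fun n => ?_⟩
  rw [hr, abs_of_nonneg (greedyOrbit_mem hq hq2 h0 h1 n).1]
  exact (greedyOrbit_mem hq hq2 h0 h1 n).2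

/-! ### Reflection x ↦ M - x, and inheritance by tails -/

theorem complement_mem {q : ℝ} (hq : 1 < q) {x : ℝ} {d : ℕ → Fin 2} (hd : d ∈ qExpansions q x) :
    (fun i => (d i).rev) ∈ qExpansions q (1 / (q - 1) - x) := by
  simp only [qExpansions, Set.mem_ofPred_eq]
  have h : (fun i => (((d i).rev : ℕ) : ℝ) / q ^ (i + 1)) =
      fun i => 1 / q ^ (i + 1) - ((d i : ℕ) : ℝ) / q ^ (i + 1) := by
    funext i
    rw [← sub_div]
    congr 1
    generalize d i = c
    fin_cases c <;> simp
  rw [h]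
  exact (hasSum_all_ones hq).sub hd

theorem qExpansions_reflect_eq {q : ℝ} (hq : 1 < q) (x : ℝ) :
    qExpansions q (1 / (q - 1) - x) = (fun (d : ℕ → Fin 2) i => (d i).rev) '' qExpansions q x := by
  ext d
  constructor
  · intro hd
    refine ⟨fun i => (d i).rev, ?_, by simp⟩
    simpa using complement_mem hq hd
  · rintro ⟨e, he, rfl⟩
    exact complement_mem hq he

theorem tail_subsingleton {q : ℝ} (hq : q ≠ 0) {x : ℝ} (h : (qExpansions q x).Subsingleton)
    (c : Fin 2) : (qExpansions q (q * x - ((c : ℕ) : ℝ))).Subsingleton := fun _ hf _ hg =>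
  consDigit_injective c (h ((consDigit_mem hq).2 hf) ((consDigit_mem hq).2 hg))

theorem tail_countable {q : ℝ} (hq : q ≠ 0) {x : ℝ} (h : (qExpansions q x).Countable)
    (c : Fin 2) : (qExpansions q (q * x - ((c : ℕ) : ℝ))).Countable :=
  Set.MapsTo.countable_of_injOn (f := consDigit c) (fun _ hf => (consDigit_mem hq).2 hf)
    (consDigit_injective c).injOn h

/-! ### Topology and cardinality of the set of expansions -/

theorem isClosed_qExpansions {q : ℝ} (hq : 1 < q) (x : ℝ) : IsClosed (qExpansions q x) := by
  have e : qExpansions q x = {d | ∑' i : ℕ, ((d i : ℕ) : ℝ) / q ^ (i + 1) = x} := by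
    ext d
    exact (summable_digits hq d).hasSum_iff
  rw [e]
  refine isClosed_eq ?_ continuous_const
  refine continuous_tsum (u := fun i : ℕ => 1 / q ^ (i + 1)) (fun i => ?_)
    (hasSum_all_ones hq).summable fun i d => ?_
  · have : Continuous fun c : Fin 2 => ((c : ℕ) : ℝ) := continuous_of_discreteTopology
    exact (this.comp (continuous_apply i)).div_const _
  · have : ((d i : ℕ) : ℝ) ≤ 1 := by exact_mod_cast (by omega : (d i : ℕ) ≤ 1)
    rw [Real.norm_of_nonneg (by positivity)]
    gcongr

theorem mk_qExpansions_of_not_countable {q : ℝ} (hq : 1 < q) {x : ℝ}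
    (h : ¬ (qExpansions q x).Countable) : Cardinal.mk (qExpansions q x) = Cardinal.continuum := by
  apply le_antisymm
  · refine (Cardinal.mk_set_le _).trans ?_
    simp
  · have : PolishSpace (ℕ → Fin 2) := { }
    obtain ⟨f, hf, -, hinj⟩ :=
      (isClosed_qExpansions hq x).exists_nat_bool_injection_of_not_countable h
    have := Cardinal.mk_le_of_injective (f := fun s => (⟨f s, hf ⟨s, rfl⟩⟩ : qExpansions q x))
      fun s t hst => hinj (congrArg Subtype.val hst)
    simpa using this

/-- If every remainder along every expansion had a second expansion, each expansion could be altered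
arbitrarily far out. The closed set would then be perfect, hence uncountable. -/
theorem exists_remainder_subsingleton {q : ℝ} (hq : 1 < q) {x : ℝ}
    (hc : (qExpansions q x).Countable) (hne : (qExpansions q x).Nonempty) :
    ∃ d ∈ qExpansions q x, ∃ n, (qExpansions q (remainder q x d n)).Subsingleton := by
  have hq0 : q ≠ 0 := by linarith
  by_contra! hcon
  have hp : Perfect (qExpansions q x) := by
    refine ⟨isClosed_qExpansions hq x, fun d hd => ?_⟩
    rw [accPt_iff_nhds]
    intro U hU
    obtain ⟨V, ⟨e, n, rfl⟩, hdV, hVU⟩ :=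
      (PiNat.isTopologicalBasis_cylinders (fun _ : ℕ => Fin 2)).mem_nhds_iff.1 hU
    rw [PiNat.mem_cylinder_iff_eq.1 hdV |>.symm] at hVU
    obtain ⟨f, hf, hfd⟩ := (hcon d hd n).exists_ne (fun i => d (i + n))
    refine ⟨splice d n f, ⟨hVU fun i hi => splice_of_lt d f hi, (splice_mem hq0).2 hf⟩, ?_⟩
    intro h
    apply hfd
    funext i
    rw [← h, splice_add]
  let := TopologicalSpace.upgradeIsCompletelyMetrizable (ℕ → Fin 2)
  obtain ⟨f, hf, -, hinj⟩ := hp.exists_nat_bool_injection hne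
  have h1 : (Set.univ : Set (ℕ → Bool)).Countable :=
    Set.MapsTo.countable_of_injOn (f := f) (fun s _ => hf ⟨s, rfl⟩) hinj.injOn hc
  have h2 := Cardinal.le_aleph0_iff_set_countable.2 h1
  simp at h2
  exact absurd Cardinal.aleph0_lt_continuum (not_lt.2 h2)

/-! ### Branching points -/

theorem mk_qExpansions_eq_add {q : ℝ} (hq : q ≠ 0) (z : ℝ) :
    Cardinal.mk (qExpansions q z) =
      Cardinal.mk (qExpansions q (q * z)) + Cardinal.mk (qExpansions q (q * z - 1)) := by
  have e : qExpansions q z =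
      consDigit 0 '' qExpansions q (q * z) ∪ consDigit 1 '' qExpansions q (q * z - 1) := by
    ext d
    constructor
    · intro hd
      have h := (mem_qExpansions_iff_tail hq z d).1 hd
      have hcons : consDigit (d 0) (fun i => d (i + 1)) = d := by
        funext i; cases i <;> rfl
      rcases Fin.exists_fin_two.1 ⟨d 0, rfl⟩ with h0 | h0
      · left
        rw [h0] at h hcons
        exact ⟨_, by simpa using h, hcons⟩
      · right
        rw [h0] at h hcons
        exact ⟨_, by simpa using h, hcons⟩
    · rintro (⟨f, hf, rfl⟩ | ⟨f, hf, rfl⟩) <;> rw [consDigit_mem hq] <;> simpa using hf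
  rw [e, Cardinal.mk_union_of_disjoint, Cardinal.mk_image_eq (consDigit_injective 0),
    Cardinal.mk_image_eq (consDigit_injective 1)]
  rw [Set.disjoint_left]
  rintro _ ⟨f, -, rfl⟩ ⟨g, -, h⟩
  exact absurd (congrFun h 0) (by simp [consDigit])

/-- All expansions agree before the first index where some two of them differ; z is the remainder at
that index. -/
theorem exists_branching_point {q : ℝ} (hq : q ≠ 0) {x : ℝ}
    (h : ¬ (qExpansions q x).Subsingleton) :
    ∃ z, Cardinal.mk (qExpansions q z) = Cardinal.mk (qExpansions q x) ∧
      (qExpansions q (q * z)).Nonempty ∧ (qExpansions q (q * z - 1)).Nonempty := by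
  classical
  have hex : ∃ n, ∃ d ∈ qExpansions q x, ∃ e ∈ qExpansions q x, d n = 0 ∧ e n = 1 := by
    obtain ⟨d, hd, e, he, hne⟩ := Set.not_subsingleton_iff.1 h
    obtain ⟨n, hn⟩ := Function.ne_iff.1 hne
    refine ⟨n, ?_⟩
    rcases Fin.exists_fin_two.1 ⟨d n, rfl⟩ with h0 | h0
    · exact ⟨d, hd, e, he, h0, by omega⟩
    · exact ⟨e, he, d, hd, by omega, h0⟩
  obtain ⟨d, hd, e, he, hd0, he1⟩ := Nat.find_spec hex
  set n := Nat.find hex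
  have hmin : ∀ f ∈ qExpansions q x, ∀ g ∈ qExpansions q x, ∀ i < n, f i = g i := by
    intro f hf g hg i hi
    by_contra hne
    refine Nat.find_min hex hi ?_
    rcases Fin.exists_fin_two.1 ⟨f i, rfl⟩ with h0 | h0
    · exact ⟨f, hf, g, hg, h0, by omega⟩
    · exact ⟨g, hg, f, hf, by omega, h0⟩
  have hde : remainder q x e n = remainder q x d n := remainder_congr (hmin e he d hd)
  refine ⟨remainder q x d n, ?_, ⟨fun i => d (i + (n + 1)), ?_⟩, ⟨fun i => e (i + (n + 1)), ?_⟩⟩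
  · have himg : qExpansions q x = splice d n '' qExpansions q (remainder q x d n) := by
      ext f
      constructor
      · intro hf
        have := shift_mem hq hf n
        rw [remainder_congr (hmin f hf d hd)] at this
        refine ⟨_, this, ?_⟩
        funext i
        by_cases hi : i < n
        · rw [splice_of_lt _ _ hi, hmin f hf d hd i hi]
        · simp only [splice, hi, if_false]
          congr 1; omega
      · rintro ⟨g, hg, rfl⟩
        exact (splice_mem hq).2 hg
    rw [himg, Cardinal.mk_image_eq]
    intro f g hfg
    funext i
    rw [← splice_add d f n i, hfg, splice_add]
  · have := shift_mem hq hd (n + 1)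
    simpa [remainder, hd0] using this
  · have := shift_mem hq he (n + 1)
    simpa [remainder, he1, hde] using this

theorem mk_qExpansions_eq_one_iff {q x : ℝ} : Cardinal.mk (qExpansions q x) = 1 ↔
    (qExpansions q x).Subsingleton ∧ (qExpansions q x).Nonempty := by
  rw [le_antisymm_iff, Cardinal.mk_le_one_iff_set_subsingleton, Cardinal.one_le_iff_ne_zero,
    Cardinal.mk_ne_zero_iff, Set.nonempty_coe_sort]

theorem eq_one_of_add_eq_two {a b : Cardinal.{0}} (ha : a ≠ 0) (hb : b ≠ 0) (h : a + b = 2) :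
    a = 1 ∧ b = 1 := by
  have h2 : (2 : Cardinal) < Cardinal.aleph0 := Cardinal.natCast_lt_aleph0 (n := 2)
  obtain ⟨m, rfl⟩ := Cardinal.lt_aleph0.1 (((self_le_add_right a b).trans h.le).trans_lt h2)
  obtain ⟨n, rfl⟩ := Cardinal.lt_aleph0.1 (((self_le_add_left b _).trans h.le).trans_lt h2)
  norm_cast at *
  omega

theorem exists_adjacent_of_mem_basesWithExactly_two {q : ℝ} (hq : q ≠ 0) {x : ℝ}
    (h : Cardinal.mk (qExpansions q x) = 2) :
    ∃ y, Cardinal.mk (qExpansions q y) = 1 ∧ Cardinal.mk (qExpansions q (y + 1)) = 1 := by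
  have hns : ¬ (qExpansions q x).Subsingleton := by
    rw [← Cardinal.mk_le_one_iff_set_subsingleton, h]
    simp
  obtain ⟨z, hz, h0, h1⟩ := exists_branching_point hq hns
  rw [h, mk_qExpansions_eq_add hq] at hz
  rw [← Set.nonempty_coe_sort, ← Cardinal.mk_ne_zero_iff] at h0 h1
  obtain ⟨e0, e1⟩ := eq_one_of_add_eq_two h0 h1 hz
  exact ⟨q * z - 1, e1, by simpa using e0⟩

/-! ### Points with a unique expansion -/

/-- A set of points outside the switch region that is stable under the forced digit
consists of points with at most one expansion. -/
theorem subsingleton_of_forced {q : ℝ} (hq : 1 < q) {G : Set ℝ}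
    (hG : ∀ x ∈ G, (q * x < 1 ∧ q * x ∈ G) ∨ (1 / (q - 1) < q * x ∧ q * x - 1 ∈ G))
    {x : ℝ} (hx : x ∈ G) : (qExpansions q x).Subsingleton := by
  have hq0 : q ≠ 0 := by linarith
  have key : ∀ x ∈ G, ∀ c : Fin 2,
      0 ≤ q * x - ((c : ℕ) : ℝ) ∧ q * x - ((c : ℕ) : ℝ) ≤ 1 / (q - 1) →
        (c = if q * x < 1 then 0 else 1) ∧ q * x - ((c : ℕ) : ℝ) ∈ G := by
    intro x hx c hc
    rcases Fin.exists_fin_two.1 ⟨c, rfl⟩ with rfl | rfl <;>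
      simp only [Fin.val_zero, Fin.val_one, Nat.cast_zero, Nat.cast_one, sub_zero] at hc ⊢ <;>
      rcases hG x hx with ⟨h, h'⟩ | ⟨h, h'⟩
    · simpa [h] using h'
    · linarith
    · linarith
    · refine ⟨?_, h'⟩
      rw [if_neg (by linarith)]
  intro d hd e he
  funext n
  induction n generalizing x d e with
  | zero =>
    have hd' := mem_interval_of_mem hq ((mem_qExpansions_iff_tail hq0 _ _).1 hd)
    have he' := mem_interval_of_mem hq ((mem_qExpansions_iff_tail hq0 _ _).1 he)
    rw [(key x hx _ hd').1, (key x hx _ he').1]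
  | succ n ih =>
    have hd' := (mem_qExpansions_iff_tail hq0 _ _).1 hd
    have he' := (mem_qExpansions_iff_tail hq0 _ _).1 he
    have hdm := key x hx _ (mem_interval_of_mem hq hd')
    have hem := key x hx _ (mem_interval_of_mem hq he')
    rw [hem.1.trans hdm.1.symm] at he'
    exact ih hdm.2 hd' he'

/-- The number with digits `0^k(10)^∞` in base `q`. -/
noncomputable def altPoint (q : ℝ) (k : ℕ) : ℝ := q / (q ^ 2 - 1) / q ^ k

theorem altPoint_pos {q : ℝ} (hq : 1 < q) (k : ℕ) : 0 < altPoint q k := by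
  have : 0 < q ^ 2 - 1 := by nlinarith
  unfold altPoint; positivity

theorem altPoint_antitone {q : ℝ} (hq : 1 < q) : Antitone (altPoint q) := by
  intro i j hij
  have : 0 < q ^ 2 - 1 := by nlinarith
  exact div_le_div_of_nonneg_left (by positivity) (by positivity)
    (pow_le_pow_right₀ hq.le hij)

theorem mul_altPoint_succ {q : ℝ} (hq : q ≠ 0) (k : ℕ) :
    q * altPoint q (k + 1) = altPoint q k := by
  unfold altPoint; field_simp; ring

theorem altPoint_zero_lt_one {q : ℝ} (hq : 1 < q) (hg : q + 1 < q ^ 2) : altPoint q 0 < 1 := by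
  have : 0 < q ^ 2 - 1 := by nlinarith
  simp only [altPoint, pow_zero, div_one]
  rw [div_lt_one this]; linarith

theorem max_sub_altPoint_zero {q : ℝ} (hq : 1 < q) :
    1 / (q - 1) - altPoint q 0 = altPoint q 1 := by
  have h1 : q - 1 ≠ 0 := by linarith
  have h2 : q + 1 ≠ 0 := by linarith
  have h3 : q ^ 2 - 1 = (q - 1) * (q + 1) := by ring
  simp only [altPoint, h3]
  field_simp
  ring

theorem mul_altPoint_zero_sub_one {q : ℝ} (hq : 1 < q) :
    q * altPoint q 0 - 1 = altPoint q 1 := by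
  have h1 : q ^ 2 - 1 ≠ 0 := by nlinarith
  simp only [altPoint]
  field_simp
  ring

theorem mul_one_div_sub_one {q : ℝ} (hq : 1 < q) : q * (1 / (q - 1)) = 1 / (q - 1) + 1 := by
  have : q - 1 ≠ 0 := by linarith
  field_simp; ring

theorem altPoint_subsingleton {q : ℝ} (hq : 1 < q) (hg : q + 1 < q ^ 2) (k : ℕ) :
    (qExpansions q (altPoint q k)).Subsingleton ∧
      (qExpansions q (1 / (q - 1) - altPoint q k)).Subsingleton := by
  have hq0 : q ≠ 0 := by linarith
  have hsmall : ∀ k, altPoint q k < 1 := fun k =>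
    (altPoint_antitone hq (Nat.zero_le k)).trans_lt (altPoint_zero_lt_one hq hg)
  have h : (qExpansions q (altPoint q k)).Subsingleton := by
    refine subsingleton_of_forced hq (G := Set.range (altPoint q)) ?_ ⟨k, rfl⟩
    rintro _ ⟨k, rfl⟩
    cases k with
    | zero =>
      right
      have h1 := mul_altPoint_zero_sub_one hq
      have h2 := max_sub_altPoint_zero hq
      exact ⟨by linarith [hsmall 0], ⟨1, h1.symm⟩⟩
    | succ k =>
      left
      rw [mul_altPoint_succ hq0]
      exact ⟨hsmall k, ⟨k, rfl⟩⟩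
  exact ⟨h, by rw [qExpansions_reflect_eq hq]; exact h.image _⟩

theorem altPoint_le_max {q : ℝ} (hq : 1 < q) (k : ℕ) : altPoint q k ≤ 1 / (q - 1) := by
  have h1 := max_sub_altPoint_zero hq
  linarith [altPoint_pos hq 1, altPoint_antitone hq (Nat.zero_le k)]

theorem mk_altPoint {q : ℝ} (hq : 1 < q) (hq2 : q < 2) (hg : q + 1 < q ^ 2) (k : ℕ) :
    Cardinal.mk (qExpansions q (altPoint q k)) = 1 ∧
      Cardinal.mk (qExpansions q (1 / (q - 1) - altPoint q k)) = 1 := by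
  have h1 := altPoint_le_max hq k
  have h2 := altPoint_pos hq k
  exact ⟨mk_qExpansions_eq_one_iff.2 ⟨(altPoint_subsingleton hq hg k).1,
      qExpansions_nonempty hq hq2 h2.le h1⟩,
    mk_qExpansions_eq_one_iff.2 ⟨(altPoint_subsingleton hq hg k).2,
      qExpansions_nonempty hq hq2 (by linarith) (by linarith)⟩⟩

/-- If 1 ≤ q x ≤ M, both successors q x and q x - 1 lie in I_q, so both digits can be continued. -/
theorem not_mem_switch_of_subsingleton {q : ℝ} (hq : 1 < q) (hq2 : q < 2) {x : ℝ}
    (h : (qExpansions q x).Subsingleton) (h1 : 1 ≤ q * x) : 1 / (q - 1) < q * x := by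
  have hq0 : q ≠ 0 := by linarith
  by_contra! h2
  obtain ⟨f, hf⟩ := qExpansions_nonempty hq hq2 (x := q * x) (by linarith) h2
  obtain ⟨g, hg⟩ := qExpansions_nonempty hq hq2 (x := q * x - 1) (by linarith) (by linarith)
  have := h ((consDigit_mem hq0 (c := 0)).2 (by simpa using hf))
    ((consDigit_mem hq0 (c := 1)).2 (by simpa using hg))
  exact absurd (congrFun this 0) (by simp [consDigit])

/-- The digits 10 are forced and return the point to [1/q, 1). The return map y ↦ q(q y - 1) is
affine of slope q^2 > 1 with fixed point `altPoint q 0`, so any other orbit would escape. -/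
theorem eq_altPoint_zero_of_subsingleton {q : ℝ} (hq : 1 < q) (hq2 : q < 2)
    (hqf : q * (q - 1) ^ 2 ≤ 1) {y : ℝ} (hy : (qExpansions q y).Subsingleton)
    (hy1 : 1 ≤ q * y) (hy2 : y < 1) : y = altPoint q 0 := by
  have hq0 : q ≠ 0 := by linarith
  have hM : q * (q - 1) ≤ 1 / (q - 1) := by
    rw [le_div_iff₀ (by linarith)]; linarith
  have hqM := mul_one_div_sub_one hq
  have step : ∀ y, (qExpansions q y).Subsingleton ∧ 1 ≤ q * y ∧ y < 1 →
      (qExpansions q (q * (q * y - 1))).Subsingleton ∧ 1 ≤ q * (q * (q * y - 1)) ∧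
        q * (q * y - 1) < 1 := by
    rintro y ⟨hy, hy1, hy2⟩
    have hyM := not_mem_switch_of_subsingleton hq hq2 hy hy1
    have hz : (qExpansions q (q * y - 1)).Subsingleton := by
      simpa using tail_subsingleton hq0 hy 1
    have hz' : (qExpansions q (q * (q * y - 1))).Subsingleton := by
      simpa using tail_subsingleton hq0 hz 0
    refine ⟨hz', ?_, ?_⟩
    · have h1 : q * (q * (1 / (q - 1) - 1)) ≤ q * (q * (q * y - 1)) := by gcongr
      have h2 : q * (q * (1 / (q - 1) - 1)) = q * (q * (1 / (q - 1))) - q * q := by ring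
      rw [hqM, mul_add, hqM] at h2
      linarith
    -- Otherwise 1 ≤ q(q y - 1) ≤ q(q - 1) ≤ M, which puts q y - 1 in the switch region.
    · by_contra! h
      have := not_mem_switch_of_subsingleton hq hq2 hz h
      have h3 : q * (q * y - 1) ≤ q * (q * 1 - 1) := by gcongr
      linarith
  have horb : ∀ n : ℕ, (qExpansions q (altPoint q 0 + (q ^ 2) ^ n * (y - altPoint q 0))).Subsingleton
      ∧ 1 ≤ q * (altPoint q 0 + (q ^ 2) ^ n * (y - altPoint q 0)) ∧
        altPoint q 0 + (q ^ 2) ^ n * (y - altPoint q 0) < 1 := by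
    intro n
    induction n with
    | zero => simpa using ⟨hy, hy1, hy2⟩
    | succ n ih =>
      have h := step _ ih
      have ha : q * (q * altPoint q 0 - 1) = altPoint q 0 := by
        rw [mul_altPoint_zero_sub_one hq, mul_altPoint_succ hq0]
      have e : q * (q * (altPoint q 0 + (q ^ 2) ^ n * (y - altPoint q 0)) - 1) =
          altPoint q 0 + (q ^ 2) ^ (n + 1) * (y - altPoint q 0) := by
        rw [pow_succ (q ^ 2) n]
        linear_combination ha
      rwa [e] at h
  by_contra hne
  have hpos : 0 < |y - altPoint q 0| := abs_pos.2 (sub_ne_zero.2 hne)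
  obtain ⟨n, hn⟩ := pow_unbounded_of_one_lt ((1 + altPoint q 0) / |y - altPoint q 0|)
    (show 1 < q ^ 2 by nlinarith)
  rw [div_lt_iff₀ hpos] at hn
  have ha := altPoint_pos hq 0
  obtain ⟨-, h1, h2⟩ := horb n
  have h3 : 0 < altPoint q 0 + (q ^ 2) ^ n * (y - altPoint q 0) :=
    pos_of_mul_pos_right (by linarith : (0 : ℝ) < q * _) (by linarith)
  have h4 : |(q ^ 2) ^ n * (y - altPoint q 0)| ≤ 1 + altPoint q 0 := by
    rw [abs_le]; constructor <;> linarith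
  rw [abs_mul, abs_of_pos (by positivity)] at h4
  linarith

/-- Digits 0 are forced until the orbit enters [1/q, 1), where only `altPoint q 0` is possible. -/
theorem eq_altPoint_of_subsingleton {q : ℝ} (hq : 1 < q) (hq2 : q < 2)
    (hqf : q * (q - 1) ^ 2 ≤ 1) {x : ℝ} (hx : (qExpansions q x).Subsingleton) (h0 : 0 < x)
    (h1 : q * x < 1) : q + 1 < q ^ 2 ∧ ∃ k, x = altPoint q k := by
  classical
  have hq0 : q ≠ 0 := by linarith
  have hex : ∃ n : ℕ, 1 ≤ q ^ n * x := by
    obtain ⟨n, hn⟩ := pow_unbounded_of_one_lt (1 / x) hq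
    exact ⟨n, ((div_lt_iff₀ h0).1 hn).le⟩
  have hn := Nat.find_spec hex
  have hmin := fun m => Nat.find_min (m := m) hex
  have hn2 : Nat.find hex ≠ 0 := by
    intro h
    rw [h] at hn
    nlinarith
  obtain ⟨n, hn3⟩ := Nat.exists_eq_succ_of_ne_zero hn2
  rw [hn3] at hn
  have hlt : q ^ n * x < 1 := not_le.1 (hmin n (by omega))
  have hsub : ∀ k : ℕ, (qExpansions q (q ^ k * x)).Subsingleton := by
    intro k
    induction k with
    | zero => simpa using hx
    | succ k ih =>
      have := tail_subsingleton hq0 ih 0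
      rw [pow_succ']
      simpa [mul_assoc] using this
  have hn' : 1 ≤ q * (q ^ n * x) := by
    rw [Nat.succ_eq_add_one, pow_succ'] at hn
    linarith
  constructor
  · have h2 := not_mem_switch_of_subsingleton hq hq2 (hsub n) hn'
    have h3 : 1 / (q - 1) < q := by nlinarith
    rw [div_lt_iff₀ (by linarith)] at h3
    nlinarith
  · refine ⟨n, ?_⟩
    have h2 := eq_altPoint_zero_of_subsingleton hq hq2 hqf (hsub n) hn' hlt
    have h3 : altPoint q n = altPoint q 0 / q ^ n := by simp [altPoint]
    rw [h3, ← h2]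
    field_simp

theorem classification_of_mk_eq_one {q : ℝ} (hq : 1 < q) (hq2 : q < 2)
    (hqf : q * (q - 1) ^ 2 ≤ 1) {x : ℝ} (hx : Cardinal.mk (qExpansions q x) = 1) :
    x = 0 ∨ x = 1 / (q - 1) ∨
      q + 1 < q ^ 2 ∧ ∃ k, x = altPoint q k ∨ x = 1 / (q - 1) - altPoint q k := by
  obtain ⟨hs, d, hd⟩ := mk_qExpansions_eq_one_iff.1 hx
  obtain ⟨h0, h1⟩ := mem_interval_of_mem hq hd
  rcases h0.eq_or_lt with h0 | h0
  · exact Or.inl h0.symm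
  rcases h1.eq_or_lt with h1 | h1
  · exact Or.inr (Or.inl h1)
  right; right
  rcases lt_or_ge (q * x) 1 with h | h
  · obtain ⟨hg, k, hk⟩ := eq_altPoint_of_subsingleton hq hq2 hqf hs h0 h
    exact ⟨hg, k, Or.inl hk⟩
  · have h2 := not_mem_switch_of_subsingleton hq hq2 hs h
    have h3 : (qExpansions q (1 / (q - 1) - x)).Subsingleton := by
      rw [qExpansions_reflect_eq hq]
      exact hs.image _
    obtain ⟨hg, k, hk⟩ := eq_altPoint_of_subsingleton hq hq2 hqf h3 (by linarith)
      (by rw [mul_sub, mul_one_div_sub_one hq]; linarith)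
    exact ⟨hg, k, Or.inr (by linarith)⟩

/-! ### Minimality of the quartic root -/

/-- These bounds place M - 1 strictly between a_2 + a_4 and a_2 + a_3 and leave no pair of indices
that could hit it. The gap to a_2 + a_4 has the quartic as numerator, so it closes exactly at r. -/
theorem altPoint_sum_bounds {q : ℝ} (hq : 1 < q) (hg : q + 1 < q ^ 2)
    (hf : q ^ 4 < 2 * q ^ 2 + q + 1) :
    1 / (q - 1) - 1 < altPoint q 1 ∧ 1 / (q - 1) - 1 < altPoint q 2 + altPoint q 3 ∧
      altPoint q 2 + altPoint q 4 < 1 / (q - 1) - 1 ∧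
      2 * altPoint q 3 ≤ altPoint q 2 + altPoint q 4 := by
  have hq0 : 0 < q := by linarith
  have h1 : 0 < q - 1 := by linarith
  have h2 : 0 < q + 1 := by linarith
  have h3 : q ^ 2 - 1 = (q - 1) * (q + 1) := by ring
  have e1 : altPoint q 1 - (1 / (q - 1) - 1) = (q ^ 2 - q - 1) / (q ^ 2 - 1) := by
    simp only [altPoint, h3]; field_simp; ring
  have e2 : altPoint q 2 + altPoint q 3 - (1 / (q - 1) - 1) =
      (q - 1) * (q ^ 2 - q - 1) / (q ^ 2 * (q - 1)) := by
    simp only [altPoint, h3]; field_simp; ring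
  have e3 : 1 / (q - 1) - 1 - (altPoint q 2 + altPoint q 4) =
      (2 * q ^ 2 + q + 1 - q ^ 4) / (q ^ 3 * (q + 1)) := by
    simp only [altPoint, h3]; field_simp; ring
  have e4 : altPoint q 2 + altPoint q 4 - 2 * altPoint q 3 =
      (q - 1) ^ 2 * altPoint q 4 := by
    simp only [altPoint, h3]; field_simp; ring
  have h5 : 0 < q ^ 2 - q - 1 := by linarith
  have h6 : 0 < 2 * q ^ 2 + q + 1 - q ^ 4 := by linarith
  have h7 : 0 < q ^ 2 - 1 := by rw [h3]; positivity
  have h8 := altPoint_pos hq 4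
  have p1 : 0 < (q ^ 2 - q - 1) / (q ^ 2 - 1) := by positivity
  have p2 : 0 < (q - 1) * (q ^ 2 - q - 1) / (q ^ 2 * (q - 1)) := by positivity
  have p3 : 0 < (2 * q ^ 2 + q + 1 - q ^ 4) / (q ^ 3 * (q + 1)) := by positivity
  have p4 : 0 ≤ (q - 1) ^ 2 * altPoint q 4 := by positivity
  refine ⟨?_, ?_, ?_, ?_⟩ <;> linarith

theorem altPoint_ne_max_sub_one {q : ℝ} (hq : 1 < q) (hg : q + 1 < q ^ 2)
    (hf : q ^ 4 < 2 * q ^ 2 + q + 1) (k : ℕ) : altPoint q k ≠ 1 / (q - 1) - 1 := by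
  obtain ⟨h1, -, h3, -⟩ := altPoint_sum_bounds hq hg hf
  intro h
  rcases Nat.lt_or_ge k 2 with hk | hk
  · linarith [altPoint_antitone hq (by omega : k ≤ 1)]
  · linarith [altPoint_antitone hq hk, altPoint_pos hq 4]

theorem altPoint_add_ne_max_sub_one {q : ℝ} (hq : 1 < q) (hg : q + 1 < q ^ 2)
    (hf : q ^ 4 < 2 * q ^ 2 + q + 1) (j k : ℕ) :
    altPoint q j + altPoint q k ≠ 1 / (q - 1) - 1 := by
  wlog hjk : j ≤ k generalizing j k
  · rw [add_comm]; exact this k j (by omega)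
  obtain ⟨h1, h2, h3, h4⟩ := altPoint_sum_bounds hq hg hf
  have anti := altPoint_antitone hq
  intro h
  rcases Nat.lt_or_ge j 2 with hj | hj
  · linarith [anti (by omega : j ≤ 1), altPoint_pos hq k]
  rcases hj.eq_or_lt with rfl | hj
  · rcases Nat.lt_or_ge k 4 with hk | hk
    · linarith [anti (by omega : k ≤ 3)]
    · linarith [anti hk]
  · linarith [anti hj, anti (hj.trans_le hjk : 3 ≤ k)]

theorem quartic_nonneg_of_adjacent {q : ℝ} (hq : 1 < q) (hq2 : q < 2)
    (hqf : q * (q - 1) ^ 2 ≤ 1) {y : ℝ} (hy : Cardinal.mk (qExpansions q y) = 1)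
    (hy1 : Cardinal.mk (qExpansions q (y + 1)) = 1) : 2 * q ^ 2 + q + 1 ≤ q ^ 4 := by
  by_contra! hf
  obtain ⟨-, d, hd⟩ := mk_qExpansions_eq_one_iff.1 hy
  obtain ⟨h0, -⟩ := mem_interval_of_mem hq hd
  obtain ⟨-, e, he⟩ := mk_qExpansions_eq_one_iff.1 hy1
  obtain ⟨-, h1⟩ := mem_interval_of_mem hq he
  have hM : 1 < 1 / (q - 1) := by rw [lt_div_iff₀ (by linarith)]; linarith
  rcases classification_of_mk_eq_one hq hq2 hqf hy1 with h | h | ⟨hg, k, h | h⟩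
  · linarith
  · rcases classification_of_mk_eq_one hq hq2 hqf hy with h' | h' | ⟨hg, j, h' | h'⟩
    · linarith
    · linarith
    · exact altPoint_ne_max_sub_one hq hg hf j (by linarith)
    · linarith [altPoint_antitone hq (Nat.zero_le j), altPoint_zero_lt_one hq hg]
  · linarith [altPoint_antitone hq (Nat.zero_le k), altPoint_zero_lt_one hq hg]
  · rcases classification_of_mk_eq_one hq hq2 hqf hy with h' | h' | ⟨hg, j, h' | h'⟩
    · exact altPoint_ne_max_sub_one hq hg hf k (by linarith)
    · linarith
    · exact altPoint_add_ne_max_sub_one hq hg hf j k (by linarith)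
    · linarith [altPoint_antitone hq (Nat.zero_le j), altPoint_zero_lt_one hq hg]

theorem exists_quartic_root : ∃ r : ℝ, 1.71 < r ∧ r < 1.711 ∧ r ^ 4 = 2 * r ^ 2 + r + 1 := by
  have hc : ContinuousOn (fun r : ℝ => r ^ 4 - (2 * r ^ 2 + r + 1)) (Set.Icc 1.71 1.711) := by
    fun_prop
  obtain ⟨r, hr, h⟩ := intermediate_value_Ioo (by norm_num) hc
    (show (0 : ℝ) ∈ _ from ⟨by norm_num, by norm_num⟩)
  exact ⟨r, hr.1, hr.2, by simp only at h; linarith⟩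

theorem one_add_altPoint_two {r : ℝ} (hr : 1 < r) (h : r ^ 4 = 2 * r ^ 2 + r + 1) :
    altPoint r 2 + 1 = 1 / (r - 1) - altPoint r 4 := by
  have hr0 : r ≠ 0 := by linarith
  have h1 : r - 1 ≠ 0 := by linarith
  have h2 : r + 1 ≠ 0 := by linarith
  have h3 : r ^ 2 - 1 = (r - 1) * (r + 1) := by ring
  simp only [altPoint, h3]
  field_simp
  linear_combination (r - 1) * h

theorem isLeast_basesWithExactly_two {r : ℝ} (h1 : 1.71 < r) (h2 : r < 1.711)
    (h : r ^ 4 = 2 * r ^ 2 + r + 1) : IsLeast (basesWithExactly 2) r := by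
  have hr : 1 < r := by linarith
  have hr2 : r < 2 := by linarith
  have hr0 : r ≠ 0 := by linarith
  constructor
  · have hg : r + 1 < r ^ 2 := by nlinarith
    -- The witness branches to a_2 + 1 = M - a_4 and to a_2.
    have e : r * ((altPoint r 2 + 1) / r) = altPoint r 2 + 1 := by field_simp
    have hc : Cardinal.mk (qExpansions r ((altPoint r 2 + 1) / r)) = 2 := by
      rw [mk_qExpansions_eq_add hr0, e, add_sub_cancel_right, one_add_altPoint_two hr h,
        (mk_altPoint hr hr2 hg 2).1, (mk_altPoint hr hr2 hg 4).2]
      norm_num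
    refine ⟨⟨hr, hr2⟩, _, ?_, hc⟩
    have : (qExpansions r ((altPoint r 2 + 1) / r)).Nonempty := by
      rw [← Set.nonempty_coe_sort, ← Cardinal.mk_ne_zero_iff, hc]
      norm_num
    obtain ⟨d, hd⟩ := this
    exact mem_interval_of_mem hr hd
  · rintro q ⟨⟨hq, hq2⟩, x, -, hx⟩
    by_contra! hlt
    obtain ⟨y, hy, hy1⟩ := exists_adjacent_of_mem_basesWithExactly_two (by linarith) hx
    have hqf : q * (q - 1) ^ 2 ≤ 1 := by
      have h3 : (q - 1) ^ 2 ≤ 0.711 ^ 2 := pow_le_pow_left₀ (by linarith) (by linarith) 2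
      nlinarith
    have h4 := quartic_nonneg_of_adjacent hq hq2 hqf hy hy1
    -- The quartic t^4 - 2t^2 - t - 1 equals (t^2 - 1)^2 - t - 2; on t > 1 it cannot be nonnegative
    -- to the left of r.
    have h5 : (r ^ 2 - 1) ^ 2 - (q ^ 2 - 1) ^ 2 = r - q + (2 * q ^ 2 + q + 1 - q ^ 4) := by
      linear_combination h
    have h6 : r - q < (r ^ 2 - 1) ^ 2 - (q ^ 2 - 1) ^ 2 := by
      have : (r ^ 2 - 1) ^ 2 - (q ^ 2 - 1) ^ 2 = (r - q) * ((r + q) * (r ^ 2 + q ^ 2 - 2)) := by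
        ring
      rw [this]
      have h7 : 1 < (r + q) * (r ^ 2 + q ^ 2 - 2) := by nlinarith
      nlinarith
    linarith

/-! ### Irreducibility of the quartic -/

theorem irreducible_quartic_zmod_two :
    Irreducible (Polynomial.X ^ 4 + Polynomial.X + 1 : Polynomial (ZMod 2)) := by
  have hdeg : (Polynomial.X ^ 4 + Polynomial.X + 1 : Polynomial (ZMod 2)).natDegree = 4 := by
    compute_degree!
  have hm : (Polynomial.X ^ 4 + Polynomial.X + 1 : Polynomial (ZMod 2)).Monic := by monicity!
  have h1 : (Polynomial.X ^ 4 + Polynomial.X + 1 : Polynomial (ZMod 2)) ≠ 1 := by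
    intro h
    rw [h] at hdeg
    simp at hdeg
  rw [hm.irreducible_iff_lt_natDegree_lt h1]
  rintro g hg hgd ⟨k, hk⟩
  rw [hdeg, Finset.mem_Ioc] at hgd
  have hkm : k.Monic := hg.of_mul_monic_left (hk ▸ hm)
  have hkd : g.natDegree + k.natDegree = 4 := by
    rw [← hg.natDegree_mul hkm, ← hk, hdeg]
  have hc := fun i => congrArg (fun P => Polynomial.coeff P i) hk
  have hg2 : g.natDegree = 1 ∨ g.natDegree = 2 := by omega
  have hlin : ∀ a : ZMod 2, ¬ g.IsRoot a := by
    intro a ha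
    have := congrArg (Polynomial.eval a) hk
    rw [Polynomial.eval_mul, ha.eq_zero, zero_mul] at this
    have h2 : ∀ b : ZMod 2, b ^ 4 + b + 1 ≠ 0 := by decide
    exact h2 a (by simpa using this)
  rcases hg2 with hg2 | hg2
  · have hlead := hg.coeff_natDegree
    rw [hg2] at hlead
    refine hlin (-g.coeff 0) ?_
    rw [Polynomial.IsRoot, Polynomial.eval_eq_sum_range, hg2]
    simp [Finset.sum_range_succ, hlead, CharTwo.add_self_eq_zero]
  · have hk2 : k.natDegree = 2 := by omega
    have eg := hg.as_sum
    have ek := hkm.as_sum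
    rw [hg2] at eg
    rw [hk2] at ek
    simp only [Finset.sum_range_succ, Finset.sum_range_zero, zero_add, pow_zero, mul_one,
      pow_one] at eg ek
    generalize g.coeff 0 = b at eg
    generalize g.coeff 1 = a at eg
    generalize k.coeff 0 = d at ek
    generalize k.coeff 1 = c at ek
    have e : g * k = Polynomial.X ^ 4 + Polynomial.C (a + c) * Polynomial.X ^ 3 +
        Polynomial.C (b + a * c + d) * Polynomial.X ^ 2 +
        Polynomial.C (a * d + b * c) * Polynomial.X + Polynomial.C (b * d) := by
      rw [eg, ek]
      simp only [Polynomial.C_add, Polynomial.C_mul]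
      ring
    rw [e] at hc
    have c0 := hc 0
    have c1 := hc 1
    have c2 := hc 2
    have c3 := hc 3
    simp only [Polynomial.coeff_add, Polynomial.coeff_C_mul, Polynomial.coeff_X_pow,
      Polynomial.coeff_X, Polynomial.coeff_C, Polynomial.coeff_one] at c0 c1 c2 c3
    norm_num at c0 c1 c2 c3
    clear hc e eg ek
    -- What remains is a finite check over the coefficients of two monic quadratics over F_2.
    revert a b c d
    decide

/-- Modulo 2 the polynomial becomes X^4 + X + 1; Gauss's lemma passes from ℤ to ℚ. -/
theorem irreducible_quartic :
    Irreducible (Polynomial.X ^ 4 - 2 * Polynomial.X ^ 2 - Polynomial.X - 1 : Polynomial ℚ) := by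
  have hm : (Polynomial.X ^ 4 - 2 * Polynomial.X ^ 2 - Polynomial.X - 1 : Polynomial ℤ).Monic := by
    monicity!
  have hz : Irreducible
      (Polynomial.X ^ 4 - 2 * Polynomial.X ^ 2 - Polynomial.X - 1 : Polynomial ℤ) := by
    refine hm.irreducible_of_irreducible_map (Int.castRingHom (ZMod 2)) _ ?_
    have h2 : (2 : Polynomial (ZMod 2)) = 0 := CharTwo.two_eq_zero
    convert irreducible_quartic_zmod_two using 1
    simp only [Polynomial.map_sub, Polynomial.map_mul, Polynomial.map_pow, Polynomial.map_X,
      Polynomial.map_one, Polynomial.map_ofNat]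
    linear_combination (-Polynomial.X ^ 2 - Polynomial.X - 1) * h2
  have := (Polynomial.IsPrimitive.Int.irreducible_iff_irreducible_map_cast hm.isPrimitive).1 hz
  simpa using this

/-! ### Constraints from the conjugate embedding -/

/-- `s` lies in `[p / (p² - 1), 1 / (p² - 1)]`, the range of the sums `∑ d_i / p ^ i` with digits
`d_i ∈ {0, 1}` when `p < -1`. -/
def IsDigitRange (p s : ℝ) : Prop := p ≤ (p ^ 2 - 1) * s ∧ (p ^ 2 - 1) * s ≤ 1

/-- After scaling by p^2 - 1 the range is [p, 1]. Adding 0 or p^2 - 1 lands in [p, p^2], and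
division by p < 0 maps this back onto [p, 1]. -/
theorem IsDigitRange.of_mul_eq {p s t : ℝ} (hp : p < -1) (hs : IsDigitRange p s) (c : Fin 2)
    (h : p * t = s + ((c : ℕ) : ℝ)) : IsDigitRange p t := by
  have hD : 0 < p ^ 2 - 1 := by nlinarith
  obtain ⟨h1, h2⟩ := hs
  have hc0 : 0 ≤ ((c : ℕ) : ℝ) := by positivity
  have hc1 : ((c : ℕ) : ℝ) ≤ 1 := by exact_mod_cast (by omega : (c : ℕ) ≤ 1)
  have e : p * ((p ^ 2 - 1) * t) = (p ^ 2 - 1) * s + (p ^ 2 - 1) * ((c : ℕ) : ℝ) := by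
    linear_combination (p ^ 2 - 1) * h
  have h3 : 0 ≤ (p ^ 2 - 1) * ((c : ℕ) : ℝ) := by positivity
  have h4 : (p ^ 2 - 1) * ((c : ℕ) : ℝ) ≤ (p ^ 2 - 1) * 1 := by gcongr
  constructor <;> nlinarith

theorem div_pow_bounds {p : ℝ} (hp : p < -1) (k : ℕ) : p ≤ p / p ^ k ∧ p / p ^ k ≤ 1 := by
  have hp0 : p ≠ 0 := by linarith
  cases k with
  | zero => simp; linarith
  | succ k =>
    have e : p / p ^ (k + 1) = (p ^ k)⁻¹ := by rw [pow_succ]; field_simp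
    have h : |(p ^ k)⁻¹| ≤ 1 := by
      rw [abs_inv, abs_pow]
      exact inv_le_one_of_one_le₀ (one_le_pow₀ (by rw [abs_of_neg] <;> linarith))
    rw [e]
    rw [abs_le] at h
    exact ⟨by linarith, h.2⟩

section Conjugate

variable {K : Type*} [Field K] {φ ψ : K →+* ℝ} {ρ : K} {q p : ℝ}

theorem exists_conjugate_of_mk_eq_one (hφ : φ ρ = q) (hψ : ψ ρ = p) (hq : 1 < q) (hq2 : q < 2)
    (hqf : q * (q - 1) ^ 2 ≤ 1) (hp : p < -1) {x : ℝ} (hx : Cardinal.mk (qExpansions q x) = 1) :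
    ∃ X : K, φ X = x ∧ IsDigitRange p (ψ X) := by
  have hD : p ^ 2 - 1 ≠ 0 := by nlinarith
  have hp1 : p - 1 ≠ 0 := by linarith
  have halt : ∀ k, φ (ρ / (ρ ^ 2 - 1) / ρ ^ k) = altPoint q k := by
    intro k; simp [altPoint, hφ]
  have halt' : ∀ k, (p ^ 2 - 1) * ψ (ρ / (ρ ^ 2 - 1) / ρ ^ k) = p / p ^ k := by
    intro k
    simp only [map_div₀, map_sub, map_pow, map_one, hψ]
    field_simp
  have hM : (p ^ 2 - 1) * ψ (1 / (ρ - 1)) = p + 1 := by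
    simp only [map_div₀, map_sub, map_one, hψ]
    field_simp
    ring
  rcases classification_of_mk_eq_one hq hq2 hqf hx with h | h | ⟨-, k, h | h⟩
  · exact ⟨0, by simp [h], by rw [map_zero]; constructor <;> linarith⟩
  · exact ⟨1 / (ρ - 1), by simp [h, hφ], by constructor <;> linarith⟩
  · refine ⟨_, (halt k).trans h.symm, ?_⟩
    rw [IsDigitRange, halt']
    exact div_pow_bounds hp k
  · refine ⟨1 / (ρ - 1) - ρ / (ρ ^ 2 - 1) / ρ ^ k, ?_, ?_⟩
    · rw [map_sub, halt, h]; simp [hφ]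
    · rw [IsDigitRange, map_sub, mul_sub, halt', hM]
      have := div_pow_bounds hp k
      constructor <;> linarith

/-- Starting from a remainder with a unique expansion, the digits are put back one at a time; each
step stays in the field and in the digit range. -/
theorem exists_conjugate_of_countable (hφ : φ ρ = q) (hψ : ψ ρ = p) (hq : 1 < q) (hq2 : q < 2)
    (hqf : q * (q - 1) ^ 2 ≤ 1) (hp : p < -1) {x : ℝ} (hx : (qExpansions q x).Countable)
    (hne : (qExpansions q x).Nonempty) : ∃ X : K, φ X = x ∧ IsDigitRange p (ψ X) := by
  obtain ⟨d, hd, n, hn⟩ := exists_remainder_subsingleton hq hx hne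
  have hq0 : q ≠ 0 := by linarith
  have hp0 : p ≠ 0 := by linarith
  have hend := exists_conjugate_of_mk_eq_one hφ hψ hq hq2 hqf hp
    (mk_qExpansions_eq_one_iff.2 ⟨hn, _, shift_mem hq0 hd n⟩)
  clear hn
  induction n with
  | zero => exact hend
  | succ n ih =>
    obtain ⟨Z, hZ, hr⟩ := hend
    refine ih ⟨(Z + ((d n : ℕ) : K)) / ρ, ?_, hr.of_mul_eq hp (d n) ?_⟩
    · rw [map_div₀, map_add, map_natCast, hZ, hφ, remainder]
      field_simp
      ring
    · rw [map_div₀, map_add, map_natCast, hψ]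
      field_simp

theorem conjugate_of_countable (hφ : φ ρ = q) (hψ : ψ ρ = p) (hq : 1 < q) (hq2 : q < 2)
    (hqf : q * (q - 1) ^ 2 ≤ 1) (hp : p < -1) {X : K} (hx : (qExpansions q (φ X)).Countable)
    (hne : (qExpansions q (φ X)).Nonempty) : IsDigitRange p (ψ X) := by
  obtain ⟨Y, hY, h⟩ := exists_conjugate_of_countable hφ hψ hq hq2 hqf hp hx hne
  rwa [φ.injective hY] at h

/-- Digit 1 from u + 1 bounds the conjugate of u from above. That excludes digits 001-free starts
such as 01 for u; if 000 is possible for u, it gives the opposite bound with equality, which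
determines u. -/
theorem eq_or_lt_of_adjacent_countable (hφ : φ ρ = q) (hψ : ψ ρ = p) (hq : 1.71 < q)
    (hq2 : q < 1.711) (hp : p < -1.345) (hp2 : p ^ 4 = 2 * p ^ 2 + p + 1)
    {u : ℝ} (hu : (qExpansions q u).Countable) (hune : (qExpansions q u).Nonempty)
    (hv : (qExpansions q (u + 1)).Countable) (hvne : (qExpansions q (u + 1)).Nonempty) :
    u = altPoint q 4 ∨ 1 / (q - 1) < q ^ 3 * u := by
  have hq1 : 1 < q := by linarith
  have hq2' : q < 2 := by linarith
  have hq0 : q ≠ 0 := by linarith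
  have hp1 : p < -1 := by linarith
  have hqf : q * (q - 1) ^ 2 ≤ 1 := by
    have h3 : (q - 1) ^ 2 ≤ 0.711 ^ 2 := pow_le_pow_left₀ (by linarith) (by linarith) 2
    nlinarith
  obtain ⟨U, rfl, -⟩ := exists_conjugate_of_countable hφ hψ hq1 hq2' hqf hp1 hu hune
  have conj : ∀ X : K, (qExpansions q (φ X)).Countable → (qExpansions q (φ X)).Nonempty →
      IsDigitRange p (ψ X) := fun X =>
    conjugate_of_countable hφ hψ hq1 hq2' hqf hp1
  obtain ⟨d, hd⟩ := hune
  obtain ⟨e, he⟩ := hvne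
  obtain ⟨hu0, -⟩ := mem_interval_of_mem hq1 hd
  obtain ⟨-, hu1⟩ := mem_interval_of_mem hq1 he
  have hM := mul_one_div_sub_one hq1
  have hM1 : q * (q * (1 / (q - 1) - 1)) = 1 / (q - 1) + 1 + q - q ^ 2 := by
    linear_combination (q + 1) * hM
  have hmono : q * (φ U + 1) ≤ q * (1 / (q - 1)) := by gcongr
  have hmono2 : q * (q * φ U) ≤ q * (q * (1 / (q - 1) - 1)) := by gcongr; linarith
  have hD : 0 < p ^ 2 - 1 := by nlinarith
  have hA : p ≤ (p ^ 2 - 1) * (p * (ψ U + 1) - 1) := by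
    have e : φ (ρ * (U + 1) - 1) = q * (φ U + 1) - 1 := by simp [hφ]
    have h := conj (ρ * (U + 1) - 1) (by rw [e]; simpa using tail_countable hq0 hv 1)
      (by
        rw [e]
        exact qExpansions_nonempty hq1 hq2' (by nlinarith) (by linarith))
    have := h.1
    simpa [hψ] using this
  have hu' : (qExpansions q (q * φ U)).Countable := by simpa using tail_countable hq0 hu 0
  have hu'' : (qExpansions q (q * (q * φ U))).Countable := by simpa using tail_countable hq0 hu' 0
  have hlt : q * (q * φ U) < 1 := by
    by_contra! hge
    have e : φ (ρ * (ρ * U) - 1) = q * (q * φ U) - 1 := by simp [hφ]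
    have h := (conj (ρ * (ρ * U) - 1) (by rw [e]; simpa using tail_countable hq0 hu' 1)
      (by
        rw [e]
        exact qExpansions_nonempty hq1 hq2' (by linarith) (by nlinarith))).1
    simp only [map_sub, map_mul, map_one, hψ] at h
    have h2 : p * ((p ^ 2 - 1) * (p * (ψ U + 1) - 1)) ≤ p * p :=
      mul_le_mul_of_nonpos_left hA (by linarith)
    -- The quadratic vanishes at (1 - √13)/2 ≈ -1.303, so p < -1.345 leaves room.
    have h3 : 0 < (-p) * (p ^ 2 - p - 3) := mul_pos (by linarith) (by nlinarith)
    nlinarith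
  rcases lt_or_ge (1 / (q - 1)) (q ^ 3 * φ U) with h | h
  · exact Or.inr h
  left
  have e : φ (ρ ^ 3 * U) = q ^ 3 * φ U := by simp [hφ]
  have h3 := (conj (ρ ^ 3 * U)
    (by
      rw [e]
      have := tail_countable hq0 hu'' 0
      simp only [Fin.val_zero, Nat.cast_zero, sub_zero] at this
      rwa [show q ^ 3 * φ U = q * (q * (q * φ U)) by ring])
    (by
      rw [e]
      exact qExpansions_nonempty hq1 hq2' (by positivity) h)).2
  simp only [map_mul, map_pow, hψ] at h3
  have h4 : p ^ 2 * p ≤ p ^ 2 * ((p ^ 2 - 1) * (p * (ψ U + 1) - 1)) :=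
    mul_le_mul_of_nonneg_left hA (by positivity)
  have h5 : (p ^ 2 - 1) * (p ^ 3 * ψ U) = 1 := by
    refine le_antisymm h3 ?_
    -- By the quartic relation the lower bound coming from u + 1 is exactly the upper end 1 of the
    -- digit range.
    have h6 : p ^ 2 * p - p ^ 2 * ((p ^ 2 - 1) * (p - 1)) = 1 := by
      linear_combination (1 - p) * hp2
    nlinarith
  have h6 : (ρ ^ 2 - 1) * (ρ ^ 3 * U) = 1 := by
    apply ψ.injective
    simpa [hψ] using h5
  have h7 : (q ^ 2 - 1) * (q ^ 3 * φ U) = 1 := by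
    have := congrArg φ h6
    simpa [hφ] using this
  have h8 : q ^ 2 - 1 ≠ 0 := by nlinarith
  rw [altPoint]
  field_simp
  linear_combination h7

end Conjugate

/-! ### The number field, and the count at the quartic root -/

theorem exists_conjugate_root : ∃ p : ℝ, p < -1.345 ∧ p ^ 4 = 2 * p ^ 2 + p + 1 := by
  have hc : ContinuousOn (fun r : ℝ => r ^ 4 - (2 * r ^ 2 + r + 1)) (Set.Icc (-2) (-1.345)) := by
    fun_prop
  obtain ⟨r, hr, h⟩ := intermediate_value_Ioo' (by norm_num) hc
    (show (0 : ℝ) ∈ _ from ⟨by norm_num, by norm_num⟩)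
  exact ⟨r, hr.2, by simp only at h; linarith⟩

theorem exists_field_with_conjugate_embeddings {r p : ℝ} (hr : r ^ 4 = 2 * r ^ 2 + r + 1)
    (hp : p ^ 4 = 2 * p ^ 2 + p + 1) :
    ∃ (K : Type) (_ : Field K) (φ ψ : K →+* ℝ) (ρ : K), φ ρ = r ∧ ψ ρ = p := by
  have : Fact (Irreducible
    (Polynomial.X ^ 4 - 2 * Polynomial.X ^ 2 - Polynomial.X - 1 : Polynomial ℚ)) :=
    ⟨irreducible_quartic⟩
  have ev : ∀ t : ℝ, t ^ 4 = 2 * t ^ 2 + t + 1 → Polynomial.eval₂ (algebraMap ℚ ℝ) t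
      (Polynomial.X ^ 4 - 2 * Polynomial.X ^ 2 - Polynomial.X - 1 : Polynomial ℚ) = 0 := by
    intro t ht
    simp [Polynomial.eval₂_sub, Polynomial.eval₂_mul]
    linarith
  exact ⟨AdjoinRoot (Polynomial.X ^ 4 - 2 * Polynomial.X ^ 2 - Polynomial.X - 1 : Polynomial ℚ),
    inferInstance, AdjoinRoot.lift _ r (ev r hr), AdjoinRoot.lift _ p (ev p hp),
    AdjoinRoot.root _, AdjoinRoot.lift_root _, AdjoinRoot.lift_root _⟩

theorem mk_eq_two_of_countable {r : ℝ} (h1 : 1.71 < r) (h2 : r < 1.711)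
    (h : r ^ 4 = 2 * r ^ 2 + r + 1) {x : ℝ} (hc : (qExpansions r x).Countable)
    (hs : ¬ (qExpansions r x).Subsingleton) : Cardinal.mk (qExpansions r x) = 2 := by
  have hr : 1 < r := by linarith
  have hr2 : r < 2 := by linarith
  have hr0 : r ≠ 0 := by linarith
  have hg : r + 1 < r ^ 2 := by nlinarith
  obtain ⟨p, hp1, hp⟩ := exists_conjugate_root
  obtain ⟨K, _, φ, ψ, ρ, hφ, hψ⟩ := exists_field_with_conjugate_embeddings h hp
  obtain ⟨z, hz, hne0, hne1⟩ := exists_branching_point hr0 hs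
  have hzc : (qExpansions r z).Countable := by
    rw [← Cardinal.le_aleph0_iff_set_countable, hz, Cardinal.le_aleph0_iff_set_countable]
    exact hc
  have hc0 : (qExpansions r (r * z)).Countable := by simpa using tail_countable hr0 hzc 0
  have hc1 : (qExpansions r (r * z - 1)).Countable := by simpa using tail_countable hr0 hzc 1
  rw [← hz, mk_qExpansions_eq_add hr0]
  have halt := one_add_altPoint_two hr h
  have key : altPoint r 4 = r * z - 1 ∨ altPoint r 2 = r * z - 1 := by
    have ha := eq_or_lt_of_adjacent_countable hφ hψ h1 h2 hp1 hp hc1 hne1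
      (by simpa using hc0) (by simpa using hne0)
    -- Reflection sends the adjacent pair r z - 1, r z to the adjacent pair M - r z, M - r z + 1.
    have hb := eq_or_lt_of_adjacent_countable hφ hψ h1 h2 hp1 hp
      (u := 1 / (r - 1) - r * z)
      (by rw [qExpansions_reflect_eq hr]; exact hc0.image _)
      (by rw [qExpansions_reflect_eq hr]; exact hne0.image _)
      (by
        rw [show 1 / (r - 1) - r * z + 1 = 1 / (r - 1) - (r * z - 1) by ring,
          qExpansions_reflect_eq hr]
        exact hc1.image _)
      (by
        rw [show 1 / (r - 1) - r * z + 1 = 1 / (r - 1) - (r * z - 1) by ring,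
          qExpansions_reflect_eq hr]
        exact hne1.image _)
    rcases ha with ha | ha
    · exact Or.inl ha.symm
    rcases hb with hb | hb
    · exact Or.inr (by linarith)
    -- Adding the two strict bounds gives r^3(M - 1) > 2M, but r^3(M - 1) = M + 1 + r + r^2 - r^3
    -- and 1 + r + r^2 - r^3 < M.
    exfalso
    have hM := mul_one_div_sub_one hr
    have e : r ^ 3 * (r * z - 1) + r ^ 3 * (1 / (r - 1) - r * z) =
        1 / (r - 1) + 1 + r + r ^ 2 - r ^ 3 := by
      linear_combination (r ^ 2 + r + 1) * hM
    have h5 : 1.4 < 1 / (r - 1) := by rw [lt_div_iff₀ (by linarith)]; linarith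
    nlinarith [mul_pos (sub_pos.2 h1) (sub_pos.2 h1)]
  rcases key with h4 | h4 <;> rw [← h4]
  · rw [show r * z = 1 / (r - 1) - altPoint r 2 by linarith, (mk_altPoint hr hr2 hg 4).1,
      (mk_altPoint hr hr2 hg 2).2]
    norm_num
  · rw [show r * z = 1 / (r - 1) - altPoint r 4 by linarith, (mk_altPoint hr hr2 hg 2).1,
      (mk_altPoint hr hr2 hg 4).2]
    norm_num

/-- The infimum `q₂` of `𝓑₂` is attained (so `q₂ = min 𝓑₂`), and every `x ∈ I_{q₂}` has exactly
one, exactly two, or a continuum of `q₂`-expansions. -/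
theorem corollary4 :
    IsLeast (basesWithExactly 2) qTwo ∧
      ∀ x ∈ expansionInterval qTwo,
        Cardinal.mk (qExpansions qTwo x) = 1 ∨
          Cardinal.mk (qExpansions qTwo x) = 2 ∨
            Cardinal.mk (qExpansions qTwo x) = Cardinal.continuum := by
  obtain ⟨r, h1, h2, h⟩ := exists_quartic_root
  have hl := isLeast_basesWithExactly_two h1 h2 h
  have e : qTwo = r := hl.csInf_eq
  rw [e]
  refine ⟨hl, fun x hx => ?_⟩
  by_cases hc : (qExpansions r x).Countable
  · by_cases hs : (qExpansions r x).Subsingleton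
    · exact Or.inl (mk_qExpansions_eq_one_iff.2
        ⟨hs, qExpansions_nonempty (by linarith) (by linarith) hx.1 hx.2⟩)
    · exact Or.inr (Or.inl (mk_eq_two_of_countable h1 h2 h hc hs))
  · exact Or.inr (Or.inr (mk_qExpansions_of_not_countable (by linarith) hc))
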